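/- Let $\mathbb{F}_q$ be the finite field with $q$ elements, and let $g,h\in\mathbb{F}_q[x]$ be coprime polynomials with $\max(\deg g,\deg h)=2$. Let $n>1$ be an integer. Then the number of monic irreducible polynomials $f\in\mathbb{F}_q[x]$ of degree $n$ such that the polynomial $h(x)^n\cdot f\bigl(g(x)/h(x)\bigr)\in\mathbb{F}_q[x]$ is irreducible over $\mathbb{F}_q$ equals $$ \begin{cases} 0 & \text{if } q \text{ is even and } g'=h'=0,\\[2pt] \dfrac{1}{2n}\,(q^n-1) & \text{if } q \text{ is odd and } n \text{ is a power of } 2,\\[4pt] \dfrac{1}{2n}\displaystyle\sum_{\substack{d\mid n\\ d\text{ odd}}}\mu(d)\,q^{n/d} & \text{otherwise,} \end{cases} $$ where $g',h'$ are the formal derivatives, $\mu$ is the Möbius function, and the sum runs over the positive odd divisors $d$ of $n$. -/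

import Mathlib

open Polynomial

/-- The quadratic transform `f_R = h ^ (deg f) * f (g / h)` of a polynomial `f` with respect to
`R = g / h`, with denominators cleared: if `f = ∑ aᵢ xⁱ` has degree `n`, then
`f_R = ∑ aᵢ gⁱ hⁿ⁻ⁱ`. See `algebraMap_quadraticTransform` for the identity in `K(x)`. -/
noncomputable def quadraticTransform {K : Type*} [Field K] (g h f : K[X]) : K[X] :=
  ∑ i ∈ Finset.range (f.natDegree + 1), C (f.coeff i) * g ^ i * h ^ (f.natDegree - i)

/-- In the field `K(x)` of rational functions, `quadraticTransform g h f` is literally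
`h ^ (deg f) * f (g / h)`. -/
theorem algebraMap_quadraticTransform {K : Type*} [Field K] (g h f : K[X]) (hh : h ≠ 0) :
    algebraMap K[X] (RatFunc K) (quadraticTransform g h f) =
      algebraMap K[X] (RatFunc K) h ^ f.natDegree *
        aeval (algebraMap K[X] (RatFunc K) g / algebraMap K[X] (RatFunc K) h) f := by
  have hh' : algebraMap K[X] (RatFunc K) h ≠ 0 := RatFunc.algebraMap_ne_zero hh
  rw [quadraticTransform, map_sum, aeval_eq_sum_range, Finset.mul_sum]
  refine Finset.sum_congr rfl fun i hi => ?_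
  have hi' : i ≤ f.natDegree := Nat.lt_succ_iff.mp (Finset.mem_range.mp hi)
  have hp : algebraMap K[X] (RatFunc K) h ^ f.natDegree =
      algebraMap K[X] (RatFunc K) h ^ (f.natDegree - i) * algebraMap K[X] (RatFunc K) h ^ i := by
    rw [← pow_add, Nat.sub_add_cancel hi']
  have hC : algebraMap K[X] (RatFunc K) (C (f.coeff i)) = algebraMap K (RatFunc K) (f.coeff i) := by
    rw [← Polynomial.algebraMap_eq, ← IsScalarTower.algebraMap_apply]
  rw [hp, map_mul, map_mul, map_pow, map_pow, hC, Algebra.smul_def, div_pow]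
  field_simp

/-- The set of monic irreducible polynomials `f` of degree `n` over `K` such that
`h ^ n * f (g / h)` is irreducible. -/
def irreducibleTransformSet {K : Type*} [Field K] (g h : K[X]) (n : ℕ) : Set K[X] :=
  {f | f.Monic ∧ Irreducible f ∧ f.natDegree = n ∧ Irreducible (quadraticTransform g h f)}

/-! Let `α` be a root of `f`, of degree `n`. The zeros of `f_R` lying over `α` are the roots of the
quadratic `g - α h` over `F(α)`, so `f_R` is irreducible iff that quadratic has no root in `F_{q^n}`
(`irreducible_quadraticTransform_minpoly_iff`). Each `f` accounts for `n` such inert `α`, so it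
suffices to count these.

Drop the condition that `α` has exact degree and suppose `deg h ≤ 1`. Counting the fibres of `g / h`
on `F_{q^m}` gives `2 * inert = q^m + (zeros of h) - (finite ramification points)`
(`two_mul_ncard_inertSet`). For `m = 2^k r` with `r` odd, an inert element has degree `2^k d` with
`d ∣ r`, so Möbius inversion over odd divisors recovers the exact-degree count. The correction term
depends only on `k`, hence survives only for `r = 1`, where it is `-1` for odd `q` and `0` for even
`q`. A Möbius change of coordinate on the target reduces `deg h = 2` to this case. If the Wronskian
vanishes, every fibre is a double point and nothing is inert. -/

/-! ### Frobenius iterates and degrees of algebraic elements. -/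

section FrobeniusOrbits

variable {F A : Type*} [Field F] [Fintype F] [Field A] [Algebra F A]

variable (F A) in
/-- The `m`-th iterate of the Frobenius endomorphism of `A` over the finite field `F`. -/
noncomputable def frobeniusIter (m : ℕ) : A →ₐ[F] A := FiniteField.frobeniusAlgHom F A ^ m

theorem frobeniusIter_apply (m : ℕ) (x : A) :
    frobeniusIter F A m x = x ^ Fintype.card F ^ m := by
  rw [frobeniusIter, AlgHom.coe_pow, FiniteField.coe_frobeniusAlgHom, pow_iterate]

theorem frobeniusIter_add (m k : ℕ) (x : A) :
    frobeniusIter F A (m + k) x = frobeniusIter F A m (frobeniusIter F A k x) := by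
  simp only [frobeniusIter, pow_add, AlgHom.mul_apply]

theorem frobeniusIter_injective (m : ℕ) : Function.Injective (frobeniusIter F A m) :=
  (frobeniusIter F A m).toRingHom.injective

theorem frobeniusIter_mul_fixed {m : ℕ} {x : A} (hx : frobeniusIter F A m x = x) (k : ℕ) :
    frobeniusIter F A (m * k) x = x := by
  induction k with
  | zero => simp [frobeniusIter]
  | succ k ih => rw [Nat.mul_succ, frobeniusIter_add, hx, ih]

theorem frobeniusIter_fixed_of_dvd {m k : ℕ} (h : m ∣ k) {x : A}
    (hx : frobeniusIter F A m x = x) : frobeniusIter F A k x = x := by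
  obtain ⟨c, rfl⟩ := h
  exact frobeniusIter_mul_fixed hx c

/-- An odd multiple of `m` is `m` modulo `2 * m`. This makes inertness persist in extensions of odd
degree. -/
theorem frobeniusIter_mul_odd {m : ℕ} {x : A} (hx : frobeniusIter F A (2 * m) x = x)
    {k : ℕ} (hk : Odd k) : frobeniusIter F A (m * k) x = frobeniusIter F A m x := by
  obtain ⟨c, rfl⟩ := hk
  rw [show m * (2 * c + 1) = m + 2 * m * c by ring, frobeniusIter_add,
    frobeniusIter_mul_fixed hx]

theorem frobeniusIter_aeval (m : ℕ) (x : A) (p : F[X]) :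
    frobeniusIter F A m (aeval x p) = aeval (frobeniusIter F A m x) p :=
  (aeval_algHom_apply _ _ _).symm

variable [Algebra.IsAlgebraic F A]

theorem natDegree_minpoly_dvd_iff (x : A) (m : ℕ) :
    (minpoly F x).natDegree ∣ m ↔ frobeniusIter F A m x = x := by
  rw [(minpoly.irreducible (Algebra.IsIntegral.isIntegral x)
    ).natDegree_dvd_iff_dvd_X_pow_card_pow_sub_X, minpoly.dvd_iff, frobeniusIter_apply]
  simp [sub_eq_zero]

omit [Fintype F] in
theorem natDegree_minpoly_pos (x : A) : 0 < (minpoly F x).natDegree :=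
  minpoly.natDegree_pos (Algebra.IsIntegral.isIntegral x)

/-- Roots of a nonzero polynomial of degree at most two are fixed by the square of Frobenius. -/
theorem frobeniusIter_two_of_aeval_eq_zero {p : F[X]} (hp : p ≠ 0) (hd : p.natDegree ≤ 2)
    {x : A} (hx : aeval x p = 0) : frobeniusIter F A 2 x = x := by
  rw [← natDegree_minpoly_dvd_iff]
  have h1 := natDegree_le_of_dvd (minpoly.dvd F x hx) hp
  have h2 := natDegree_minpoly_pos (F := F) x
  have : (minpoly F x).natDegree = 1 ∨ (minpoly F x).natDegree = 2 := by omega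
  rcases this with h | h <;> simp [h]

theorem ncard_fixed [IsAlgClosed A] {m : ℕ} (hm : m ≠ 0) :
    {x : A | frobeniusIter F A m x = x}.Finite ∧
    {x : A | frobeniusIter F A m x = x}.ncard = Fintype.card F ^ m := by
  classical
  have hq : 1 < Fintype.card F ^ m := Nat.one_lt_pow hm Fintype.one_lt_card
  have h0 : (X ^ (Fintype.card F ^ m) - X : A[X]) ≠ 0 :=
    FiniteField.X_pow_card_sub_X_ne_zero A hq
  have hset : {x : A | frobeniusIter F A m x = x} =
      ((X ^ (Fintype.card F ^ m) - X : A[X]).roots.toFinset : Set A) := by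
    ext x
    simp [h0, frobeniusIter_apply, sub_eq_zero]
  obtain ⟨p, _, k, hp, hcard⟩ := FiniteField.card' F
  have : CharP A p := charP_of_injective_algebraMap' F p
  have hdvd : p ∣ Fintype.card F ^ m := by
    rw [hcard]; exact dvd_pow (dvd_pow_self _ k.pos.ne') hm
  have hsep := galois_poly_separable (K := A) p _ hdvd
  rw [hset]
  refine ⟨Finset.finite_toSet _, ?_⟩
  rw [Set.ncard_coe_finset, Multiset.toFinset_card_of_nodup (nodup_roots hsep),
    ← (IsAlgClosed.splits _).natDegree_eq_card_roots,
    FiniteField.X_pow_card_sub_X_natDegree_eq A hq]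

end FrobeniusOrbits

/-! ### The quadratic pencil `g - α h` and the degree of the transform. -/

section Pencil

variable {F A : Type*} [Field F] [Field A] [Algebra F A] {g h : F[X]}

theorem aeval_eq_of_natDegree_le_two {p : F[X]} (hp : p.natDegree ≤ 2) (x : A) :
    aeval x p = algebraMap F A (p.coeff 2) * x ^ 2 + algebraMap F A (p.coeff 1) * x +
      algebraMap F A (p.coeff 0) := by
  rw [aeval_eq_sum_range' (Nat.lt_succ_of_le hp)]
  simp [Finset.sum_range_succ, Algebra.smul_def]
  ring

theorem aeval_ne_zero_of_isCoprime (hgh : IsCoprime g h) {α β : A}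
    (hβ : aeval β g = α * aeval β h) : aeval β h ≠ 0 := by
  intro h0
  obtain ⟨a, b, hab⟩ := hgh
  have := congrArg (aeval β) hab
  simp [hβ, h0] at this

/-- A member of the pencil `g - α h` which has a root and whose quadratic coefficient does not
vanish splits into linear factors. -/
theorem pencil_eq_mul (hg : g.natDegree ≤ 2) (hh : h.natDegree ≤ 2) {α β : A}
    (hlc : algebraMap F A (g.coeff 2) - α * algebraMap F A (h.coeff 2) ≠ 0)
    (hβ : aeval β g = α * aeval β h) :
    ∃ γ : A, ∀ x : A, aeval x g - α * aeval x h =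
      (algebraMap F A (g.coeff 2) - α * algebraMap F A (h.coeff 2)) * ((x - β) * (x - γ)) := by
  simp only [aeval_eq_of_natDegree_le_two hg, aeval_eq_of_natDegree_le_two hh] at hβ ⊢
  set a := algebraMap F A (g.coeff 2) - α * algebraMap F A (h.coeff 2) with ha
  set b := algebraMap F A (g.coeff 1) - α * algebraMap F A (h.coeff 1) with hb
  -- The second root, from the sum of the roots `-b / a`.
  refine ⟨-b / a - β, fun x => ?_⟩
  have e : a * ((x - β) * (x - (-b / a - β))) = a * (x - β) * (x + β) + b * (x - β) := by
    field_simp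
    ring
  rw [e, ha, hb]
  linear_combination hβ

theorem exists_pencil_root [IsAlgClosed A] (hg : g.natDegree ≤ 2) (hh : h.natDegree ≤ 2) {α : A}
    (hlc : algebraMap F A (g.coeff 2) - α * algebraMap F A (h.coeff 2) ≠ 0) :
    ∃ β : A, aeval β g = α * aeval β h := by
  have hd : (C (algebraMap F A (g.coeff 2) - α * algebraMap F A (h.coeff 2)) * X ^ 2 +
      C (algebraMap F A (g.coeff 1) - α * algebraMap F A (h.coeff 1)) * X +
      C (algebraMap F A (g.coeff 0) - α * algebraMap F A (h.coeff 0))).degree = 2 :=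
    degree_quadratic hlc
  obtain ⟨β, hβ⟩ := IsAlgClosed.exists_root _ (by rw [hd]; decide)
  refine ⟨β, ?_⟩
  rw [aeval_eq_of_natDegree_le_two hg, aeval_eq_of_natDegree_le_two hh]
  simp only [IsRoot, eval_add, eval_mul, eval_C, eval_pow, eval_X] at hβ
  linear_combination hβ

theorem coeff_two_ne_zero_of_max_natDegree (hdeg : max g.natDegree h.natDegree = 2)
    (hh : h.coeff 2 = 0) : g.coeff 2 ≠ 0 := by
  intro hg
  rcases max_choice g.natDegree h.natDegree with hm | hm
  · rw [hdeg] at hm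
    have : g.leadingCoeff = 0 := by rw [leadingCoeff, ← hm, hg]
    simp [leadingCoeff_eq_zero.mp this] at hm
  · rw [hdeg] at hm
    have : h.leadingCoeff = 0 := by rw [leadingCoeff, ← hm, hh]
    simp [leadingCoeff_eq_zero.mp this] at hm

/-- If `α` is not in the base field, the quadratic coefficient of `g - α h` does not vanish. -/
theorem pencil_coeff_ne_zero (hdeg : max g.natDegree h.natDegree = 2) {α : A}
    (hα : (minpoly F α).natDegree ≠ 1) :
    algebraMap F A (g.coeff 2) - α * algebraMap F A (h.coeff 2) ≠ 0 := by
  intro h0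
  by_cases hh : h.coeff 2 = 0
  · exact coeff_two_ne_zero_of_max_natDegree hdeg hh (by simpa [hh] using h0)
  · have hh' : algebraMap F A (h.coeff 2) ≠ 0 := by simpa using hh
    apply hα
    have : α = algebraMap F A (g.coeff 2 / h.coeff 2) := by
      rw [map_div₀, eq_div_iff hh']
      linear_combination -h0
    rw [this, minpoly.eq_X_sub_C, natDegree_X_sub_C]

theorem aeval_quadraticTransform {f : F[X]} {α β : A} (hβ : aeval β g = α * aeval β h) :
    aeval β (quadraticTransform g h f) = aeval β h ^ f.natDegree * aeval α f := by
  rw [quadraticTransform, map_sum, aeval_eq_sum_range (p := f), Finset.mul_sum]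
  refine Finset.sum_congr rfl fun i hi => ?_
  have hi' : i ≤ f.natDegree := Nat.lt_succ_iff.mp (Finset.mem_range.mp hi)
  rw [← Nat.sub_add_cancel hi']
  simp only [map_mul, map_pow, aeval_C, hβ, Algebra.smul_def, Nat.add_sub_cancel]
  rw [mul_pow, pow_add]
  ring

theorem natDegree_quadraticTransform_le (hg : g.natDegree ≤ 2) (hh : h.natDegree ≤ 2) (f : F[X]) :
    (quadraticTransform g h f).natDegree ≤ 2 * f.natDegree := by
  refine natDegree_sum_le_of_forall_le _ _ fun i hi => ?_
  have hi' : i ≤ f.natDegree := Nat.lt_succ_iff.mp (Finset.mem_range.mp hi)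
  have h1 := natDegree_pow_le_of_le i hg
  have h2 := natDegree_pow_le_of_le (f.natDegree - i) hh
  have h3 : (C (f.coeff i) * g ^ i * h ^ (f.natDegree - i)).natDegree ≤
      i * 2 + (f.natDegree - i) * 2 :=
    natDegree_mul_le_of_le (natDegree_C_mul_le _ _ |>.trans h1) h2
  omega

theorem coeff_quadraticTransform (hg : g.natDegree ≤ 2) (hh : h.natDegree ≤ 2) (f : F[X]) :
    (quadraticTransform g h f).coeff (2 * f.natDegree) =
      ∑ i ∈ Finset.range (f.natDegree + 1),
        f.coeff i * g.coeff 2 ^ i * h.coeff 2 ^ (f.natDegree - i) := by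
  rw [quadraticTransform, finsetSum_coeff]
  refine Finset.sum_congr rfl fun i hi => ?_
  have hi' : i ≤ f.natDegree := Nat.lt_succ_iff.mp (Finset.mem_range.mp hi)
  rw [show 2 * f.natDegree = i * 2 + (f.natDegree - i) * 2 by omega, mul_assoc, coeff_C_mul,
    coeff_mul_add_eq_of_natDegree_le (natDegree_pow_le_of_le i hg)
      (natDegree_pow_le_of_le (f.natDegree - i) hh), coeff_pow_of_natDegree_le hg,
    coeff_pow_of_natDegree_le hh, mul_assoc]

/-- The coefficient in degree `2 * deg f` is the homogenization of `f` at `(g.coeff 2, h.coeff 2)`.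
Its vanishing would give `f` a root in `F`, impossible for an irreducible `f` of degree above one.
-/
theorem natDegree_quadraticTransform (hdeg : max g.natDegree h.natDegree = 2) {f : F[X]}
    (hf : Irreducible f) (hn : 1 < f.natDegree) :
    (quadraticTransform g h f).natDegree = 2 * f.natDegree := by
  have hg : g.natDegree ≤ 2 := hdeg ▸ le_max_left _ _
  have hh : h.natDegree ≤ 2 := hdeg ▸ le_max_right _ _
  refine natDegree_eq_of_le_of_coeff_ne_zero (natDegree_quadraticTransform_le hg hh f) ?_
  rw [coeff_quadraticTransform hg hh]
  by_cases h2 : h.coeff 2 = 0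
  · rw [Finset.sum_eq_single_of_mem f.natDegree (by simp)]
    · have hg2 := coeff_two_ne_zero_of_max_natDegree hdeg h2
      simp [hg2, hf.ne_zero]
    · intro i hi hne
      have hi' : i ≤ f.natDegree := Nat.lt_succ_iff.mp (Finset.mem_range.mp hi)
      rw [h2, zero_pow (by omega), mul_zero]
  · intro h0
    have hroot : f.IsRoot (g.coeff 2 / h.coeff 2) := by
      rw [IsRoot, eval_eq_sum_range]
      apply mul_left_cancel₀ (pow_ne_zero f.natDegree h2)
      rw [mul_zero, ← h0, Finset.mul_sum]
      refine Finset.sum_congr rfl fun i hi => ?_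
      have hi' : i ≤ f.natDegree := Nat.lt_succ_iff.mp (Finset.mem_range.mp hi)
      rw [← Nat.sub_add_cancel hi', Nat.add_sub_cancel, pow_add, div_pow]
      field_simp
    exact hn.ne' (natDegree_eq_of_degree_eq_some (degree_eq_one_of_irreducible_of_root hf hroot))

end Pencil

/-! ### Frobenius action on the fibres of `g / h`; the irreducibility criterion. -/

section Orbits

variable {F A : Type*} [Field F] [Fintype F] [Field A] [Algebra F A] {g h : F[X]}

theorem frobeniusIter_pencil_root {m : ℕ} {α β : A} (hα : frobeniusIter F A m α = α)
    (hβ : aeval β g = α * aeval β h) :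
    aeval (frobeniusIter F A m β) g = α * aeval (frobeniusIter F A m β) h := by
  rw [← frobeniusIter_aeval, ← frobeniusIter_aeval, hβ, map_mul, hα]

/-- Frobenius permutes the at most two roots of the pencil member, so its square fixes each of them.
-/
theorem frobeniusIter_two_mul_pencil_root (hg : g.natDegree ≤ 2) (hh : h.natDegree ≤ 2) {m : ℕ}
    {α β : A} (hlc : algebraMap F A (g.coeff 2) - α * algebraMap F A (h.coeff 2) ≠ 0)
    (hα : frobeniusIter F A m α = α) (hβ : aeval β g = α * aeval β h) :
    frobeniusIter F A (2 * m) β = β := by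
  obtain ⟨γ, hγ⟩ := pencil_eq_mul hg hh hlc hβ
  have key : ∀ x : A, aeval x g = α * aeval x h → x = β ∨ x = γ := by
    intro x hx
    have := hγ x
    rw [hx, sub_self, eq_comm, mul_eq_zero_iff_left hlc, mul_eq_zero, sub_eq_zero,
      sub_eq_zero] at this
    exact this
  have h1 := frobeniusIter_pencil_root hα hβ
  have h2 := frobeniusIter_pencil_root hα h1
  rw [two_mul, frobeniusIter_add]
  rcases key _ h1 with e1 | e1
  · rw [e1, e1]
  · rcases key _ h2 with e2 | e2
    · exact e2
    · exact e2.trans (e1.symm.trans (frobeniusIter_injective m (e2.trans e1.symm)))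

theorem frobeniusIter_pencil_root_of_fixed (hg : g.natDegree ≤ 2) (hh : h.natDegree ≤ 2) {m : ℕ}
    {α β γ : A} (hlc : algebraMap F A (g.coeff 2) - α * algebraMap F A (h.coeff 2) ≠ 0)
    (hα : frobeniusIter F A m α = α) (hβ : aeval β g = α * aeval β h)
    (hγ : aeval γ g = α * aeval γ h) (hfix : frobeniusIter F A m β = β) :
    frobeniusIter F A m γ = γ := by
  obtain ⟨δ, hδ⟩ := pencil_eq_mul hg hh hlc hγ
  have key : ∀ x : A, aeval x g = α * aeval x h → x = γ ∨ x = δ := by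
    intro x hx
    have := hδ x
    rw [hx, sub_self, eq_comm, mul_eq_zero_iff_left hlc, mul_eq_zero, sub_eq_zero,
      sub_eq_zero] at this
    exact this
  have h1 := frobeniusIter_pencil_root hα hγ
  rcases key _ hβ with e | e
  · rwa [← e]
  · rcases key _ h1 with e1 | e1
    · exact e1
    · have : frobeniusIter F A m γ = frobeniusIter F A m β := by rw [e1, hfix, e]
      rw [frobeniusIter_injective m this, hfix]

variable [Algebra.IsAlgebraic F A]

/-- By coprimality `h` does not vanish at `β`, so `α = g(β) / h(β)` lies in `F(β)`. -/
theorem natDegree_minpoly_dvd_of_pencil_root (hgh : IsCoprime g h) {α β : A}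
    (hβ : aeval β g = α * aeval β h) :
    (minpoly F α).natDegree ∣ (minpoly F β).natDegree := by
  have h0 := aeval_ne_zero_of_isCoprime hgh hβ
  have hfix := (natDegree_minpoly_dvd_iff (F := F) β _).mp dvd_rfl
  rw [natDegree_minpoly_dvd_iff]
  have e := congrArg (frobeniusIter F A (minpoly F β).natDegree) hβ
  rw [map_mul, frobeniusIter_aeval, frobeniusIter_aeval, hfix, hβ] at e
  exact (mul_right_cancel₀ h0 e).symm

/-- The transform has degree `2n` and vanishes at every `β` over `α`. The degree of `β` is a
multiple of `n` dividing `2n`, so it is `2n`, making the transform associated to `minpoly F β`,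
exactly when `β` is not in `F_{q^n}`. -/
theorem irreducible_quadraticTransform_minpoly_iff [IsAlgClosed A] (hgh : IsCoprime g h)
    (hdeg : max g.natDegree h.natDegree = 2) {α : A} (hn : 1 < (minpoly F α).natDegree) :
    Irreducible (quadraticTransform g h (minpoly F α)) ↔
      ∀ β : A, aeval β g = α * aeval β h →
        frobeniusIter F A (minpoly F α).natDegree β ≠ β := by
  have hg : g.natDegree ≤ 2 := hdeg ▸ le_max_left _ _
  have hh : h.natDegree ≤ 2 := hdeg ▸ le_max_right _ _
  have hirr := minpoly.irreducible (Algebra.IsIntegral.isIntegral (R := F) α)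
  have hD := natDegree_quadraticTransform hdeg hirr hn
  have hlc := pencil_coeff_ne_zero hdeg hn.ne'
  have hα := (natDegree_minpoly_dvd_iff (F := F) α _).mp dvd_rfl
  have hroot : ∀ β : A, aeval β g = α * aeval β h →
      minpoly F β ∣ quadraticTransform g h (minpoly F α) := by
    intro β hβ
    apply minpoly.dvd
    rw [aeval_quadraticTransform hβ, minpoly.aeval, mul_zero]
  set n := (minpoly F α).natDegree with hndef
  have hne : quadraticTransform g h (minpoly F α) ≠ 0 := by
    intro h0
    rw [h0, natDegree_zero] at hD
    omega
  constructor
  · intro hI β hβ hfix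
    have hassoc := (minpoly.irreducible (Algebra.IsIntegral.isIntegral (R := F) β)
      ).associated_of_dvd hI (hroot β hβ)
    have hdegβ : (minpoly F β).natDegree = 2 * n :=
      (natDegree_eq_of_degree_eq (degree_eq_degree_of_associated hassoc)).trans hD
    rw [← natDegree_minpoly_dvd_iff, hdegβ] at hfix
    have := Nat.le_of_dvd (by omega) hfix
    omega
  · intro H
    obtain ⟨β, hβ⟩ := exists_pencil_root hg hh hlc
    have h2 := (natDegree_minpoly_dvd_iff β (2 * n)).mpr
      (frobeniusIter_two_mul_pencil_root hg hh hlc hα hβ)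
    have h1 : n ∣ (minpoly F β).natDegree := natDegree_minpoly_dvd_of_pencil_root hgh hβ
    have h3 : ¬ (minpoly F β).natDegree ∣ n := by
      rw [natDegree_minpoly_dvd_iff]
      exact H β hβ
    have hdegβ : (minpoly F β).natDegree = 2 * n := by
      obtain ⟨c, hc⟩ := h1
      rw [hc, mul_comm n c] at h2
      have hc2 : c ∣ 2 := Nat.dvd_of_mul_dvd_mul_right (by omega) h2
      rcases (Nat.dvd_prime Nat.prime_two).mp hc2 with rfl | rfl
      · exact absurd (by rw [hc, mul_one]) h3
      · rw [hc, mul_comm]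
    have hassoc := associated_of_dvd_of_natDegree_le (hroot β hβ) hne (by rw [hD, hdegβ])
    exact hassoc.irreducible (minpoly.irreducible (Algebra.IsIntegral.isIntegral β))

variable (A) in
/-- Elements of degree `n` over `F` for which the pencil member `g - α h` has no root in the
extension of `F` of degree `n`. -/
def primitiveInertSet (g h : F[X]) (n : ℕ) : Set A :=
  {α | (minpoly F α).natDegree = n ∧
    ∀ β : A, aeval β g = α * aeval β h → frobeniusIter F A n β ≠ β}

variable (A) in
/-- Elements `α` of the extension of `F` of degree `m` for which the pencil member `g - α h` has
no root in that extension. -/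
def inertSet (g h : F[X]) (m : ℕ) : Set A :=
  {α | frobeniusIter F A m α = α ∧
    ∀ β : A, aeval β g = α * aeval β h → frobeniusIter F A m β ≠ β}

theorem primitiveInertSet_subset (g h : F[X]) (n : ℕ) :
    primitiveInertSet A g h n ⊆ inertSet A g h n := by
  rintro α ⟨rfl, h2⟩
  exact ⟨(natDegree_minpoly_dvd_iff α _).mp dvd_rfl, h2⟩

theorem finite_inertSet [IsAlgClosed A] (g h : F[X]) {m : ℕ} (hm : m ≠ 0) :
    (inertSet A g h m).Finite :=
  (ncard_fixed hm).1.subset fun _ hx => hx.1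

theorem mem_primitiveInertSet_iff [IsAlgClosed A] (hgh : IsCoprime g h)
    (hdeg : max g.natDegree h.natDegree = 2) {n : ℕ} (hn : 1 < n) (α : A) :
    α ∈ primitiveInertSet A g h n ↔ minpoly F α ∈ irreducibleTransformSet g h n := by
  have hi := Algebra.IsIntegral.isIntegral (R := F) α
  simp only [primitiveInertSet, irreducibleTransformSet, Set.mem_ofPred_eq, minpoly.monic hi,
    minpoly.irreducible hi, true_and]
  refine and_congr_right fun h1 => ?_
  subst h1
  exact (irreducible_quadraticTransform_minpoly_iff hgh hdeg hn).symm

/-- The map `minpoly F` is `n`-to-one here: its fibre over `f` is the set of roots of `f`, distinct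
because finite fields are perfect. -/
theorem finite_irreducibleTransformSet_and_ncard [IsAlgClosed A] (hgh : IsCoprime g h)
    (hdeg : max g.natDegree h.natDegree = 2) {n : ℕ} (hn : 1 < n) :
    (irreducibleTransformSet g h n).Finite ∧
      (primitiveInertSet A g h n).ncard = n * (irreducibleTransformSet g h n).ncard := by
  classical
  have hfin : (primitiveInertSet A g h n).Finite :=
    (finite_inertSet g h (by omega)).subset (primitiveInertSet_subset g h n)
  have hmin : ∀ f ∈ irreducibleTransformSet g h n, ∀ α : A, aeval α f = 0 → minpoly F α = f :=
    fun f hf α hα => (minpoly.eq_of_irreducible_of_monic hf.2.1 hα hf.1).symm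
  have himg : irreducibleTransformSet g h n = minpoly F '' primitiveInertSet A g h n := by
    ext f
    constructor
    · intro hf
      obtain ⟨α, hα⟩ := IsAlgClosed.exists_aeval_eq_zero A f
        (degree_pos_of_irreducible hf.2.1).ne'
      have e := hmin f hf α hα
      exact ⟨α, (mem_primitiveInertSet_iff hgh hdeg hn α).mpr (e ▸ hf), e⟩
    · rintro ⟨α, hα, rfl⟩
      exact (mem_primitiveInertSet_iff hgh hdeg hn α).mp hα
  have hfin' : (irreducibleTransformSet g h n).Finite := himg ▸ hfin.image _
  refine ⟨hfin', ?_⟩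
  rw [Set.ncard_eq_toFinset_card _ hfin, Set.ncard_eq_toFinset_card _ hfin',
    Finset.card_eq_sum_card_fiberwise (f := minpoly F) (t := hfin'.toFinset)]
  · rw [Finset.sum_const_nat (m := n), mul_comm]
    intro f hf
    rw [Set.Finite.mem_toFinset] at hf
    refine Eq.trans ?_ ((card_rootSet_eq_natDegree (K := A)
      (PerfectField.separable_of_irreducible hf.2.1) (IsAlgClosed.splits _)).trans hf.2.2.1)
    rw [← Set.toFinset_card]
    congr 1
    ext α
    simp only [Finset.mem_filter, Set.Finite.mem_toFinset, Set.mem_toFinset, mem_rootSet,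
      ne_eq, hf.2.1.ne_zero, not_false_eq_true, true_and]
    constructor
    · rintro ⟨-, rfl⟩
      exact minpoly.aeval F α
    · intro hα
      have e := hmin f hf α hα
      exact ⟨(mem_primitiveInertSet_iff hgh hdeg hn α).mpr (e ▸ hf), e⟩
  · intro α hα
    simp only [Set.Finite.coe_toFinset] at hα ⊢
    exact (mem_primitiveInertSet_iff hgh hdeg hn α).mp hα

end Orbits

/-! ### Counting inert elements through the fibres of `g / h`. -/

section Counting

variable {F A : Type*} [Field F] [Fintype F] [Field A] [Algebra F A] {g h : F[X]}

-- Here `g / h` has a pole at infinity, so no finite `α` has infinity in its fibre.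
omit [Fintype F] in
theorem pencil_coeff_ne_zero_of_natDegree_le_one (hg : g.natDegree = 2) (hh : h.natDegree ≤ 1)
    (α : A) : algebraMap F A (g.coeff 2) - α * algebraMap F A (h.coeff 2) ≠ 0 := by
  have h1 : h.coeff 2 = 0 := coeff_eq_zero_of_natDegree_lt (by omega)
  have h2 : g.coeff 2 ≠ 0 := by
    rw [← hg]
    exact leadingCoeff_ne_zero.mpr (ne_zero_of_natDegree_gt (n := 1) (by omega))
  simpa [h1] using h2

-- On the fibre over `α` the Wronskian `h g' - h' g` equals `h (g - α h)'`, so it detects double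
-- roots.
omit [Fintype F] in
theorem aeval_wronskian_of_pencil_eq_mul [Infinite A] {α β γ c : A}
    (hP : ∀ x : A, aeval x g - α * aeval x h = c * ((x - β) * (x - γ))) {x : A}
    (hx : aeval x g = α * aeval x h) :
    aeval x (wronskian h g) = aeval x h * (c * ((x - β) + (x - γ))) := by
  have hpoly : g.map (algebraMap F A) - C α * h.map (algebraMap F A) =
      C c * ((X - C β) * (X - C γ)) := by
    refine Polynomial.funext fun y => ?_
    simpa [eval_map_algebraMap] using hP y
  have hd := congrArg (fun p => eval x (derivative p)) hpoly
  simp only [derivative_sub, derivative_mul, derivative_C, derivative_X, derivative_map,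
    eval_sub, eval_add, eval_mul, eval_C, eval_X, eval_map_algebraMap, zero_mul, zero_add,
    sub_zero, one_mul, mul_one] at hd
  simp only [wronskian, map_sub, map_mul]
  rw [hx]
  linear_combination aeval x h * hd

variable [IsAlgClosed A]

variable (F A) in
/-- The number of zeros of `p` in the extension of `F` of degree `m`. -/
noncomputable def fixedRootCount (p : F[X]) (m : ℕ) : ℕ :=
  {x : A | frobeniusIter F A m x = x ∧ aeval x p = 0}.ncard

variable (A) in
/-- The number of zeros of the Wronskian which are not zeros of `h`, in the extension of `F` of
degree `m`. These are the finite ramification points of `g / h`. -/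
noncomputable def fixedRamificationCount (g h : F[X]) (m : ℕ) : ℕ :=
  {x : A | frobeniusIter F A m x = x ∧ aeval x h ≠ 0 ∧ aeval x (wronskian h g) = 0}.ncard

variable [Algebra.IsAlgebraic F A]

/-- The non-poles `Y` in `F_{q^m}` map onto `U`, the complement of the inert set in `F_{q^m}`.
Counting ramification points twice makes every fibre have size two, so `2 |U|` is `|Y|` plus the
number of ramification points. -/
theorem two_mul_ncard_inertSet (hgh : IsCoprime g h) (hg : g.natDegree = 2)
    (hh : h.natDegree ≤ 1) {m : ℕ} (hm : m ≠ 0) :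
    2 * (inertSet A g h m).ncard + fixedRamificationCount A g h m =
      Fintype.card F ^ m + fixedRootCount F A h m := by
  classical
  have : Infinite A := IsAlgClosed.instInfinite
  obtain ⟨hfin, hcard⟩ := ncard_fixed (F := F) (A := A) hm
  set K := hfin.toFinset with hK
  have memK : ∀ x, x ∈ K ↔ frobeniusIter F A m x = x := by simp [hK]
  have cardK : K.card = Fintype.card F ^ m := by
    rw [← hcard, Set.ncard_eq_toFinset_card _ hfin]
  have hlc := pencil_coeff_ne_zero_of_natDegree_le_one (A := A) hg hh
  set U := K.filter fun α => ∃ β ∈ K, aeval β g = α * aeval β h with hU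
  have hV : (inertSet A g h m).ncard = (K.filter fun α =>
      ¬ ∃ β ∈ K, aeval β g = α * aeval β h).card := by
    rw [← Set.ncard_coe_finset]
    congr 1
    ext α
    simp only [inertSet, Set.mem_ofPred_eq, Finset.coe_filter, memK, not_exists, not_and]
    exact and_congr_right fun _ => forall_congr' fun β => ⟨fun H h1 h2 => H h2 h1,
      fun H h1 h2 => H h2 h1⟩
  have hZ : fixedRootCount F A h m = (K.filter fun x => aeval x h = 0).card := by
    rw [fixedRootCount, ← Set.ncard_coe_finset]
    congr 1
    ext α
    simp [memK]
  set Y := K.filter fun x => ¬ aeval x h = 0 with hY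
  have hW : fixedRamificationCount A g h m =
      (Y.filter fun x => aeval x (wronskian h g) = 0).card := by
    rw [fixedRamificationCount, ← Set.ncard_coe_finset]
    congr 1
    ext α
    simp [hY, memK, and_assoc]
  have hmaps : ∀ x ∈ Y, aeval x g / aeval x h ∈ U := by
    intro x hx
    rw [hY, Finset.mem_filter, memK] at hx
    rw [hU, Finset.mem_filter, memK]
    refine ⟨?_, x, (memK x).mpr hx.1, (div_mul_cancel₀ _ hx.2).symm⟩
    rw [map_div₀, frobeniusIter_aeval, frobeniusIter_aeval, hx.1]
  -- The sum is `2 + 0` for distinct roots and `1 + 1` for a double root.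
  have hfiber : ∀ α ∈ U, (Y.filter fun x => aeval x g / aeval x h = α).card +
      ((Y.filter fun x => aeval x (wronskian h g) = 0).filter
        fun x => aeval x g / aeval x h = α).card = 2 := by
    intro α hα
    rw [hU, Finset.mem_filter, memK] at hα
    obtain ⟨hα, β, hβ, hαβ⟩ := hα
    rw [memK] at hβ
    obtain ⟨γ, hγ⟩ := pencil_eq_mul hg.le (by omega) (hlc α) hαβ
    have hγroot : aeval γ g = α * aeval γ h := by
      have := hγ γ
      rwa [sub_self γ, mul_zero, mul_zero, sub_eq_zero] at this
    have hγfix := frobeniusIter_pencil_root_of_fixed hg.le (by omega) (hlc α) hα hαβ hγroot hβ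
    have hβ0 := aeval_ne_zero_of_isCoprime hgh hαβ
    have hγ0 := aeval_ne_zero_of_isCoprime hgh hγroot
    have hset : (Y.filter fun x => aeval x g / aeval x h = α) = {β, γ} := by
      ext x
      simp only [hY, Finset.mem_filter, memK, Finset.mem_insert, Finset.mem_singleton]
      constructor
      · rintro ⟨⟨-, h0⟩, hx⟩
        rw [div_eq_iff h0] at hx
        have := hγ x
        rw [hx, sub_self, eq_comm, mul_eq_zero_iff_left (hlc α), mul_eq_zero, sub_eq_zero,
          sub_eq_zero] at this
        exact this
      · rintro (rfl | rfl)
        · exact ⟨⟨hβ, hβ0⟩, by rw [div_eq_iff hβ0, hαβ]⟩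
        · exact ⟨⟨hγfix, hγ0⟩, by rw [div_eq_iff hγ0, hγroot]⟩
    have hWβ := aeval_wronskian_of_pencil_eq_mul hγ hαβ
    have hWγ := aeval_wronskian_of_pencil_eq_mul hγ hγroot
    rw [Finset.filter_comm (s := Y), hset]
    by_cases hβγ : β = γ
    · subst hβγ
      have hW0 : aeval β (wronskian h g) = 0 := by rw [hWβ]; ring
      simp [Finset.filter_singleton, hW0]
    · have hW1 : aeval β (wronskian h g) ≠ 0 := by
        rw [hWβ, sub_self, zero_add]
        exact mul_ne_zero hβ0 (mul_ne_zero (hlc α) (sub_ne_zero.mpr hβγ))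
      have hW2 : aeval γ (wronskian h g) ≠ 0 := by
        rw [hWγ, sub_self, add_zero]
        exact mul_ne_zero hγ0 (mul_ne_zero (hlc α) (sub_ne_zero.mpr (Ne.symm hβγ)))
      rw [Finset.filter_insert, if_neg hW1, Finset.filter_singleton, if_neg hW2,
        Finset.card_empty, Finset.card_pair hβγ]
  have h1 := Finset.card_eq_sum_card_fiberwise (f := fun x => aeval x g / aeval x h) (s := Y)
    (t := U) (fun x hx => hmaps x hx)
  have h2 := Finset.card_eq_sum_card_fiberwise (f := fun x => aeval x g / aeval x h)
    (s := Y.filter fun x => aeval x (wronskian h g) = 0) (t := U)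
    (fun x hx => hmaps x (Finset.mem_filter.mp hx).1)
  have h3 : Y.card + (Y.filter fun x => aeval x (wronskian h g) = 0).card = U.card * 2 := by
    rw [h1, h2, ← Finset.sum_add_distrib, Finset.sum_const_nat hfiber]
  have h4 := Finset.card_filter_add_card_filter_not (s := K)
    (fun α => ∃ β ∈ K, aeval β g = α * aeval β h)
  have h5 := Finset.card_filter_add_card_filter_not (s := K) (fun x => aeval x h = 0)
  rw [← hU] at h4
  rw [← hY] at h5
  rw [hV, hW, hZ, ← cardK]
  omega

/-- Let `e` be the degree of `α`. The roots over `α` lie in `F_{q^{2e}}`, so an even index `2^k r /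
e` would place them in `F_{q^{2^k r}}`. The index is therefore odd, which forces `2^k ∣ e`; across
an odd index inertness is unchanged. -/
theorem mem_inertSet_iff_exists (hg : g.natDegree = 2) (hh : h.natDegree ≤ 1) (k : ℕ)
    {r : ℕ} (hr : Odd r) (α : A) :
    α ∈ inertSet A g h (2 ^ k * r) ↔
      ∃ d ∈ r.divisors, α ∈ primitiveInertSet A g h (2 ^ k * d) := by
  have hlc := pencil_coeff_ne_zero_of_natDegree_le_one (A := A) hg hh α
  have hfix := (natDegree_minpoly_dvd_iff (F := F) α _).mp dvd_rfl
  have h2 : ∀ β : A, aeval β g = α * aeval β h →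
      frobeniusIter F A (2 * (minpoly F α).natDegree) β = β := fun β hβ =>
    frobeniusIter_two_mul_pencil_root hg.le (by omega) hlc hfix hβ
  constructor
  · rintro ⟨h1, H⟩
    rw [← natDegree_minpoly_dvd_iff] at h1
    set e := (minpoly F α).natDegree with he
    obtain ⟨c, hc⟩ := h1
    have hodd : Odd c := by
      rw [← Nat.not_even_iff_odd]
      rintro ⟨b, rfl⟩
      obtain ⟨β, hβ⟩ := exists_pencil_root hg.le (by omega) hlc
      refine H β hβ (frobeniusIter_fixed_of_dvd ⟨b, ?_⟩ (h2 β hβ))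
      rw [hc]; ring
    have hdvd : 2 ^ k ∣ e :=
      ((Nat.coprime_two_left.mpr hodd).pow_left k).dvd_of_dvd_mul_right ⟨r, hc.symm⟩
    obtain ⟨d, hd⟩ := hdvd
    have hr' : r = d * c := by
      apply Nat.eq_of_mul_eq_mul_left (Nat.two_pow_pos k)
      rw [hc, hd, mul_assoc]
    refine ⟨d, Nat.mem_divisors.mpr ⟨⟨c, hr'⟩, hr.pos.ne'⟩, by rw [← he, hd], ?_⟩
    intro β hβ hf
    refine H β hβ (frobeniusIter_fixed_of_dvd ⟨c, ?_⟩ hf)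
    rw [hr', mul_assoc]
  · rintro ⟨d, hd, h1, H⟩
    obtain ⟨c, rfl⟩ := (Nat.mem_divisors.mp hd).1
    rw [Nat.odd_mul] at hr
    rw [h1] at hfix h2
    rw [← mul_assoc]
    refine ⟨frobeniusIter_mul_fixed hfix c, fun β hβ => ?_⟩
    rw [frobeniusIter_mul_odd (h2 β hβ) hr.2]
    exact H β hβ

theorem ncard_inertSet_eq_sum (hg : g.natDegree = 2) (hh : h.natDegree ≤ 1) (k : ℕ)
    {r : ℕ} (hr : Odd r) :
    (inertSet A g h (2 ^ k * r)).ncard =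
      ∑ d ∈ r.divisors, (primitiveInertSet A g h (2 ^ k * d)).ncard := by
  classical
  have hk : 2 ^ k ≠ 0 := (Nat.two_pow_pos k).ne'
  have hfin := finite_inertSet (A := A) g h (mul_ne_zero hk hr.pos.ne')
  have hmem := mem_inertSet_iff_exists (A := A) hg hh k hr
  rw [Set.ncard_eq_toFinset_card _ hfin, Finset.card_eq_sum_card_fiberwise
    (f := fun α => (minpoly F α).natDegree) (t := r.divisors.image (2 ^ k * ·)),
    Finset.sum_image (fun a _ b _ hab => Nat.eq_of_mul_eq_mul_left (Nat.two_pow_pos k) hab)]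
  · refine Finset.sum_congr rfl fun d hd => ?_
    rw [← Set.ncard_coe_finset]
    congr 1
    ext α
    simp only [Finset.coe_filter, Set.Finite.mem_toFinset, Set.mem_ofPred_eq, hmem]
    constructor
    · rintro ⟨⟨d', _, hα⟩, h1⟩
      rwa [← hα.1.symm.trans h1]
    · intro hα
      exact ⟨⟨d, hd, hα⟩, hα.1⟩
  · intro α hα
    simp only [Set.Finite.coe_toFinset, hmem] at hα
    obtain ⟨d, hd, hα⟩ := hα
    simp only [Finset.coe_image, Set.mem_image, Finset.mem_coe]
    exact ⟨d, hd, hα.1.symm⟩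

end Counting

/-! ### Möbius inversion over odd divisors and the ramification correction. -/

section Moebius

variable {F A : Type*} [Field F] [Fintype F] [Field A] [Algebra F A] {g h : F[X]}
variable [Algebra.IsAlgebraic F A]

theorem frobeniusIter_mul_odd_of_aeval_eq_zero {p : F[X]} (hp : p ≠ 0) (hd : p.natDegree ≤ 2)
    (m : ℕ) {r : ℕ} (hr : Odd r) {x : A} (hx : aeval x p = 0) :
    frobeniusIter F A (m * r) x = frobeniusIter F A m x :=
  frobeniusIter_mul_odd (frobeniusIter_mul_fixed (frobeniusIter_two_of_aeval_eq_zero hp hd hx) m) hr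

theorem frobeniusIter_of_aeval_eq_zero_of_even {p : F[X]} (hp : p ≠ 0) (hd : p.natDegree ≤ 2)
    {m : ℕ} (hm : Even m) {x : A} (hx : aeval x p = 0) : frobeniusIter F A m x = x :=
  frobeniusIter_fixed_of_dvd hm.two_dvd (frobeniusIter_two_of_aeval_eq_zero hp hd hx)

theorem fixedRootCount_mul_odd (hp : h ≠ 0) (hd : h.natDegree ≤ 2) (m : ℕ) {r : ℕ} (hr : Odd r) :
    fixedRootCount F A h (m * r) = fixedRootCount F A h m := by
  unfold fixedRootCount
  congr 1
  ext x
  refine and_congr_left fun hx => ?_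
  rw [frobeniusIter_mul_odd_of_aeval_eq_zero hp hd m hr hx]

theorem fixedRamificationCount_mul_odd (hp : wronskian h g ≠ 0)
    (hd : (wronskian h g).natDegree ≤ 2) (m : ℕ) {r : ℕ} (hr : Odd r) :
    fixedRamificationCount A g h (m * r) = fixedRamificationCount A g h m := by
  unfold fixedRamificationCount
  congr 1
  ext x
  rw [Set.mem_ofPred_eq, Set.mem_ofPred_eq, ← and_assoc, ← and_assoc]
  refine and_congr_left fun hx => ?_
  rw [frobeniusIter_mul_odd_of_aeval_eq_zero hp hd m hr hx]

omit [Fintype F] in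
theorem natDegree_wronskian_le_two (hg : g.natDegree = 2) (hh : h.natDegree ≤ 1)
    (hW : wronskian h g ≠ 0) : (wronskian h g).natDegree ≤ 2 := by
  have := natDegree_wronskian_lt_add hW
  omega

theorem sum_divisorsAntidiagonal_moebius (r : ℕ) :
    ∑ x ∈ r.divisorsAntidiagonal, (ArithmeticFunction.moebius x.1 : ℚ) =
      if r = 1 then 1 else 0 := by
  rw [Nat.sum_divisorsAntidiagonal (fun a _ => (ArithmeticFunction.moebius a : ℚ))]
  have := congrArg (fun f : ArithmeticFunction ℤ => f r) ArithmeticFunction.moebius_mul_coe_zeta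
  simp only [ArithmeticFunction.coe_mul_zeta_apply,
    ArithmeticFunction.one_apply] at this
  exact_mod_cast this

variable [IsAlgClosed A]

/-- Zeros of `h` and of the Wronskian have degree at most two over `F`, so their counts ignore the
odd factor of `m`. The correction is thus constant in `r` and is multiplied by `∑ μ(d)`, which
vanishes unless `r = 1`. -/
theorem two_mul_ncard_primitiveInertSet (hgh : IsCoprime g h) (hg : g.natDegree = 2)
    (hh : h.natDegree ≤ 1) (hW : wronskian h g ≠ 0) (k : ℕ) {r : ℕ} (hr : Odd r) :
    2 * ((primitiveInertSet A g h (2 ^ k * r)).ncard : ℚ) =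
      ∑ d ∈ r.divisors, (ArithmeticFunction.moebius d : ℚ) *
        (Fintype.card F : ℚ) ^ (2 ^ k * (r / d)) +
      if r = 1 then (fixedRootCount F A h (2 ^ k) : ℚ) - fixedRamificationCount A g h (2 ^ k)
      else 0 := by
  have hh0 : h ≠ 0 := by
    rintro rfl
    simp at hW
  -- The summation formula is available for odd indices only; these are closed under divisors, so
  -- inversion still applies.
  have hinv := (ArithmeticFunction.sum_eq_iff_sum_mul_moebius_eq_on (R := ℚ)
    (f := fun r => ((primitiveInertSet A g h (2 ^ k * r)).ncard : ℚ))
    (g := fun r => ((inertSet A g h (2 ^ k * r)).ncard : ℚ)) {r | Odd r}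
    (fun m n hmn hn => Odd.of_dvd_nat hn hmn)).mp
    (fun n _ hn => by
      rw [ncard_inertSet_eq_sum hg hh k hn, Nat.cast_sum]) r hr.pos hr
  rw [← hinv, Finset.mul_sum]
  set c : ℚ := (fixedRootCount F A h (2 ^ k) : ℚ) - fixedRamificationCount A g h (2 ^ k) with hc
  have hterm : ∀ x ∈ r.divisorsAntidiagonal,
      2 * ((ArithmeticFunction.moebius x.1 : ℚ) * ((inertSet A g h (2 ^ k * x.2)).ncard : ℚ)) =
      (ArithmeticFunction.moebius x.1 : ℚ) * (Fintype.card F : ℚ) ^ (2 ^ k * x.2) +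
      (ArithmeticFunction.moebius x.1 : ℚ) * c := by
    intro x hx
    have hodd : Odd x.2 :=
      Odd.of_dvd_nat hr ⟨x.1, by rw [mul_comm, (Nat.mem_divisorsAntidiagonal.mp hx).1]⟩
    have e := two_mul_ncard_inertSet (A := A) hgh hg hh
      (mul_ne_zero (Nat.two_pow_pos k).ne' hodd.pos.ne')
    rw [fixedRootCount_mul_odd hh0 (by omega) _ hodd,
      fixedRamificationCount_mul_odd hW (natDegree_wronskian_le_two hg hh hW) _ hodd] at e
    have e' : 2 * ((inertSet A g h (2 ^ k * x.2)).ncard : ℚ) +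
        fixedRamificationCount A g h (2 ^ k) =
        (Fintype.card F : ℚ) ^ (2 ^ k * x.2) + fixedRootCount F A h (2 ^ k) := by
      exact_mod_cast e
    rw [hc]
    linear_combination (ArithmeticFunction.moebius x.1 : ℚ) * e'
  rw [Finset.sum_congr rfl hterm, Finset.sum_add_distrib, ← Finset.sum_mul,
    sum_divisorsAntidiagonal_moebius, Nat.sum_divisorsAntidiagonal
      (fun a b => (ArithmeticFunction.moebius a : ℚ) * (Fintype.card F : ℚ) ^ (2 ^ k * b))]
  split_ifs <;> simp

/-- For even `m` all the zeros concerned lie in `F_{q^m}`. On the projective line there are two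
ramification points, or one in characteristic two. Infinity is one of them when `h` is constant;
when `h` is linear it is an unramified pole, and `h` has one zero. -/
theorem fixedRamificationCount_of_even (hgh : IsCoprime g h) (hg : g.natDegree = 2)
    (hh : h.natDegree ≤ 1) (hW : wronskian h g ≠ 0) {m : ℕ} (hm : Even m) :
    ((2 : A) = 0 → fixedRamificationCount A g h m = fixedRootCount F A h m) ∧
    ((2 : A) ≠ 0 → fixedRamificationCount A g h m = fixedRootCount F A h m + 1) := by
  have hh0 : h ≠ 0 := by
    rintro rfl
    simp at hW
  have hz : fixedRootCount F A h m = {x : A | aeval x h = 0}.ncard := by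
    unfold fixedRootCount
    congr 1
    ext x
    exact and_iff_right_of_imp (frobeniusIter_of_aeval_eq_zero_of_even hh0 (by omega) hm)
  have hw : fixedRamificationCount A g h m =
      {x : A | aeval x h ≠ 0 ∧ aeval x (wronskian h g) = 0}.ncard := by
    unfold fixedRamificationCount
    congr 1
    ext x
    exact and_iff_right_of_imp fun hx => frobeniusIter_of_aeval_eq_zero_of_even hW
      (natDegree_wronskian_le_two hg hh hW) hm hx.2
  obtain ⟨s, t, u, hs, rfl⟩ : ∃ s t u : F, s ≠ 0 ∧ C s * X ^ 2 + C t * X + C u = g :=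
    ⟨g.coeff 2, g.coeff 1, g.coeff 0, by
      rw [← hg]; exact leadingCoeff_ne_zero.mpr (ne_zero_of_natDegree_gt (n := 1) (by omega)),
      (eq_quadratic_of_degree_le_two (natDegree_le_iff_degree_le.mp hg.le)).symm⟩
  obtain ⟨c, e, rfl⟩ : ∃ c e : F, C c * X + C e = h :=
    ⟨h.coeff 1, h.coeff 0, (eq_X_add_C_of_natDegree_le_one hh).symm⟩
  rw [hz, hw]
  have hWx : ∀ x : A, aeval x (wronskian (C c * X + C e) (C s * X ^ 2 + C t * X + C u)) =
      (algebraMap F A c * x + algebraMap F A e) * (2 * algebraMap F A s * x + algebraMap F A t) -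
      algebraMap F A c *
        (algebraMap F A s * x ^ 2 + algebraMap F A t * x + algebraMap F A u) := by
    intro x
    simp only [wronskian, derivative_mul, derivative_C, derivative_X,
      derivative_X_pow, map_add, map_sub, map_mul, map_pow, aeval_C, aeval_X, map_zero, map_one,
      map_natCast]
    push_cast
    ring
  have hhx : ∀ x : A, aeval x (C c * X + C e) = algebraMap F A c * x + algebraMap F A e := by
    intro x
    simp
  have hgx : ∀ x : A, aeval x (C s * X ^ 2 + C t * X + C u) =
      algebraMap F A s * x ^ 2 + algebraMap F A t * x + algebraMap F A u := by
    intro x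
    simp
  have hs' : algebraMap F A s ≠ 0 := by simpa using hs
  have hcop : ∀ x : A, aeval x (C c * X + C e) = 0 →
      aeval x (C s * X ^ 2 + C t * X + C u) ≠ 0 := by
    intro x hx hx'
    exact aeval_ne_zero_of_isCoprime hgh (α := 0) (by rw [hx', zero_mul]) hx
  -- Restating `hW` by values in `A` lets the coefficients be generalized to elements of `A`.
  have hW' : ∃ x : A, aeval x (wronskian (C c * X + C e) (C s * X ^ 2 + C t * X + C u)) ≠ 0 := by
    have : Infinite A := IsAlgClosed.instInfinite
    by_contra! H
    apply hW
    apply map_injective (algebraMap F A) (algebraMap F A).injective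
    refine Polynomial.funext fun x => ?_
    rw [eval_map_algebraMap, H x, Polynomial.map_zero, eval_zero]
  simp only [hWx, hhx, hgx] at hcop hW' ⊢
  clear hz hw hWx hhx hgx hW
  generalize algebraMap F A s = s' at *
  generalize algebraMap F A t = t' at *
  generalize algebraMap F A u = u' at *
  have hce : algebraMap F A c = 0 → algebraMap F A e ≠ 0 := by
    intro h1 h2
    apply hh0
    rw [map_eq_zero] at h1 h2
    simp [h1, h2]
  generalize algebraMap F A c = c' at *
  generalize algebraMap F A e = e' at *
  by_cases hc : c' = 0
  · subst hc
    have he := hce rfl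
    simp only [zero_mul, zero_add, sub_zero] at hW' ⊢
    have hz : {x : A | e' = 0} = ∅ := by simp [he]
    rw [hz, Set.ncard_empty]
    constructor
    · intro h2
      rw [h2] at hW' ⊢
      simp only [zero_mul, zero_add, mul_ne_zero_iff, exists_const] at hW'
      simp [hW'.1, hW'.2]
    · intro h2
      rw [Set.ncard_eq_one]
      refine ⟨-t' / (2 * s'), ?_⟩
      ext x
      simp only [Set.mem_ofPred_eq, ne_eq, he, not_false_eq_true, true_and, Set.mem_singleton_iff,
        mul_eq_zero, false_or]
      rw [eq_div_iff (mul_ne_zero h2 hs')]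
      constructor <;> intro hx <;> linear_combination hx
  -- Completing the square: `c' * W = s' * ((c' x + e')^2 - ρ^2)`, where `s' * ρ^2` is `c'^2` times
  -- the value of `g` at the zero of `h`. Coprimality makes `ρ` nonzero.
  · obtain ⟨ρ, hρ⟩ := IsAlgClosed.exists_pow_nat_eq
      ((s' * e' ^ 2 - e' * c' * t' + c' ^ 2 * u') / s') (n := 2) (by norm_num)
    rw [eq_div_iff hs'] at hρ
    have hroot := hcop (-e' / c') (by field_simp; ring)
    have hρ0 : ρ ≠ 0 := by
      rintro rfl
      apply hroot
      field_simp
      linear_combination -hρ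
    have hz : {x : A | c' * x + e' = 0} = {-e' / c'} := by
      ext x
      simp only [Set.mem_ofPred_eq, Set.mem_singleton_iff]
      rw [eq_div_iff hc]
      constructor <;> intro hx <;> linear_combination hx
    have hw : {x : A | c' * x + e' ≠ 0 ∧ (c' * x + e') * (2 * s' * x + t') -
        c' * (s' * x ^ 2 + t' * x + u') = 0} = {(ρ - e') / c', (-ρ - e') / c'} := by
      ext x
      have key : c' * ((c' * x + e') * (2 * s' * x + t') - c' * (s' * x ^ 2 + t' * x + u')) =
          s' * ((c' * x + e' - ρ) * (c' * x + e' + ρ)) := by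
        linear_combination hρ
      simp only [Set.mem_ofPred_eq, Set.mem_insert_iff, Set.mem_singleton_iff]
      rw [eq_div_iff hc, eq_div_iff hc, ← mul_eq_zero_iff_left hc, key, mul_eq_zero_iff_left hs',
        mul_eq_zero]
      constructor
      · rintro ⟨-, hx | hx⟩
        · left; linear_combination hx
        · right; linear_combination hx
      · rintro (hx | hx)
        · refine ⟨?_, Or.inl (by linear_combination hx)⟩
          rw [show c' * x + e' = ρ by linear_combination hx]
          exact hρ0
        · refine ⟨?_, Or.inr (by linear_combination hx)⟩
          rw [show c' * x + e' = -ρ by linear_combination hx]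
          exact neg_ne_zero.mpr hρ0
    rw [hz, hw, Set.ncard_singleton]
    constructor
    · intro h2
      have : -ρ = ρ := by linear_combination -ρ * h2
      rw [this, Set.pair_eq_singleton, Set.ncard_singleton]
    · intro h2
      apply Set.ncard_pair
      intro H
      rw [div_left_inj' hc] at H
      exact mul_ne_zero h2 hρ0 (by linear_combination H)

end Moebius

/-! ### Change of coordinate, vanishing Wronskian, and the count for general `g / h`. -/

section Final

variable {F A : Type*} [Field F] [Fintype F] [Field A] [Algebra F A] {g h : F[X]}
variable [Algebra.IsAlgebraic F A]

/-- Replacing the map `g / h` by `1 / (g / h - a)` transforms primitive inert elements by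
`α ↦ 1 / (α - a)`. -/
theorem primitiveInertSet_sub_C_mul (g h : F[X]) (a : F) {n : ℕ} (hn : 1 < n) :
    primitiveInertSet A h (g - C a * h) n =
      (fun α => (α - algebraMap F A a)⁻¹) '' primitiveInertSet A g h n := by
  have hnat : ∀ α : A,
      (minpoly F (α - algebraMap F A a)⁻¹).natDegree = (minpoly F α).natDegree := by
    intro α
    have key : ∀ m, (minpoly F (α - algebraMap F A a)⁻¹).natDegree ∣ m ↔
        (minpoly F α).natDegree ∣ m := by
      intro m
      rw [natDegree_minpoly_dvd_iff, natDegree_minpoly_dvd_iff, map_inv₀, map_sub,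
        AlgHom.commutes, inv_inj, sub_left_inj]
    exact Nat.dvd_antisymm ((key _).mpr dvd_rfl) ((key _).mp dvd_rfl)
  have hpencil : ∀ α : A, α - algebraMap F A a ≠ 0 → ∀ β : A,
      aeval β h = (α - algebraMap F A a)⁻¹ * aeval β (g - C a * h) ↔
        aeval β g = α * aeval β h := by
    intro α hα β
    rw [eq_inv_mul_iff_mul_eq₀ hα, map_sub, map_mul, aeval_C]
    constructor <;> intro hx <;> linear_combination -hx
  have hne : ∀ α : A, (minpoly F α).natDegree = n → α - algebraMap F A a ≠ 0 := by
    intro α hα h0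
    rw [sub_eq_zero] at h0
    rw [h0, minpoly.eq_X_sub_C, natDegree_X_sub_C] at hα
    omega
  have hmem : ∀ α : A, (minpoly F α).natDegree = n →
      ((α - algebraMap F A a)⁻¹ ∈ primitiveInertSet A h (g - C a * h) n ↔
        α ∈ primitiveInertSet A g h n) := by
    intro α hα
    simp only [primitiveInertSet, Set.mem_ofPred_eq, hnat, hpencil α (hne α hα)]
  ext δ
  constructor
  · intro hδ
    have e : (δ⁻¹ + algebraMap F A a - algebraMap F A a)⁻¹ = δ := by
      rw [add_sub_cancel_right, inv_inv]
    refine ⟨δ⁻¹ + algebraMap F A a, ?_, e⟩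
    have hd : (minpoly F (δ⁻¹ + algebraMap F A a)).natDegree = n := by
      rw [← hnat, e]
      exact hδ.1
    rw [← hmem _ hd, e]
    exact hδ
  · rintro ⟨α, hα, rfl⟩
    exact (hmem α hα.1).mpr hα

theorem ncard_primitiveInertSet_sub_C_mul (g h : F[X]) (a : F) {n : ℕ} (hn : 1 < n) :
    (primitiveInertSet A h (g - C a * h) n).ncard = (primitiveInertSet A g h n).ncard := by
  rw [primitiveInertSet_sub_C_mul g h a hn]
  apply Set.ncard_image_of_injective
  intro x y hxy
  simpa using hxy

variable [IsAlgClosed A]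

/-- The pencil member over `α` has a double root, and Frobenius must fix its only root. -/
theorem primitiveInertSet_eq_empty_of_wronskian_eq_zero (hgh : IsCoprime g h)
    (hdeg : max g.natDegree h.natDegree = 2) (hW : wronskian h g = 0) {n : ℕ} (hn : 1 < n) :
    primitiveInertSet A g h n = ∅ := by
  have : Infinite A := IsAlgClosed.instInfinite
  have hg : g.natDegree ≤ 2 := hdeg ▸ le_max_left _ _
  have hh : h.natDegree ≤ 2 := hdeg ▸ le_max_right _ _
  rw [Set.eq_empty_iff_forall_notMem]
  intro α hα
  have hlc := pencil_coeff_ne_zero (α := α) hdeg (by rw [hα.1]; omega)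
  obtain ⟨β, hβ⟩ := exists_pencil_root hg hh hlc
  obtain ⟨γ, hγ⟩ := pencil_eq_mul hg hh hlc hβ
  have h1 := aeval_wronskian_of_pencil_eq_mul hγ hβ
  rw [hW, map_zero, eq_comm, mul_eq_zero_iff_left (aeval_ne_zero_of_isCoprime hgh hβ),
    mul_eq_zero_iff_left hlc, sub_self, zero_add, sub_eq_zero] at h1
  subst h1
  have h2 := frobeniusIter_pencil_root (primitiveInertSet_subset g h n hα).1 hβ
  have h3 := hγ (frobeniusIter F A n β)
  rw [h2, sub_self, eq_comm, mul_eq_zero_iff_left hlc, mul_self_eq_zero, sub_eq_zero] at h3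
  exact hα.2 β hβ h3

theorem two_mul_ncard_primitiveInertSet_of_natDegree_le_one (hgh : IsCoprime g h)
    (hg : g.natDegree = 2) (hh : h.natDegree ≤ 1) (hW : wronskian h g ≠ 0) (k : ℕ) {r : ℕ}
    (hr : Odd r) (hn : 1 < 2 ^ k * r) :
    2 * ((primitiveInertSet A g h (2 ^ k * r)).ncard : ℚ) =
      ∑ d ∈ r.divisors, (ArithmeticFunction.moebius d : ℚ) *
        (Fintype.card F : ℚ) ^ (2 ^ k * (r / d)) -
      if r = 1 ∧ Odd (Fintype.card F) then 1 else 0 := by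
  rw [two_mul_ncard_primitiveInertSet hgh hg hh hW k hr]
  by_cases hr1 : r = 1
  · subst hr1
    -- With `r = 1`, the bound `1 < n` excludes `k = 0`.
    have hk : Even (2 ^ k) := by
      refine Nat.even_pow.mpr ⟨even_two, ?_⟩
      rintro rfl
      simp at hn
    obtain ⟨h0, h1⟩ := fixedRamificationCount_of_even (A := A) hgh hg hh hW hk
    have hchar : (2 : A) = 0 ↔ ¬ Odd (Fintype.card F) := by
      have hc : (2 : A) = 0 ↔ (2 : F) = 0 := by
        rw [← map_ofNat (algebraMap F A) 2, map_eq_zero]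
      rw [hc, Nat.not_odd_iff_even]
      constructor
      · intro h2
        by_contra hodd
        obtain ⟨c, hc⟩ := Nat.not_even_iff_odd.mp hodd
        have := FiniteField.cast_card_eq_zero F
        rw [hc] at this
        simp [h2] at this
      · intro heven
        obtain ⟨p, _, m, hp, hcard⟩ := FiniteField.card' F
        rw [hcard] at heven
        have : 2 ∣ p := Nat.prime_two.dvd_of_dvd_pow heven.two_dvd
        have h2p : 2 = p := (Nat.prime_dvd_prime_iff_eq Nat.prime_two hp).mp this
        subst h2p
        exact_mod_cast CharP.cast_eq_zero F 2
    by_cases h2 : (2 : A) = 0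
    · rw [h0 h2]
      simp [hchar.mp h2]
    · rw [h1 h2]
      simp [not_not.mp (fun h => h2 (hchar.mpr h))]
      ring
  · simp [hr1]

theorem two_mul_ncard_primitiveInertSet_of_max_natDegree (hgh : IsCoprime g h)
    (hdeg : max g.natDegree h.natDegree = 2) (hW : wronskian h g ≠ 0) (k : ℕ) {r : ℕ}
    (hr : Odd r) (hn : 1 < 2 ^ k * r) :
    2 * ((primitiveInertSet A g h (2 ^ k * r)).ncard : ℚ) =
      ∑ d ∈ r.divisors, (ArithmeticFunction.moebius d : ℚ) *
        (Fintype.card F : ℚ) ^ (2 ^ k * (r / d)) -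
      if r = 1 ∧ Odd (Fintype.card F) then 1 else 0 := by
  have hg : g.natDegree ≤ 2 := hdeg ▸ le_max_left _ _
  have hh : h.natDegree ≤ 2 := hdeg ▸ le_max_right _ _
  have hlt : ∀ p : F[X], p.natDegree ≤ 2 → p.coeff 2 = 0 → p.natDegree ≤ 1 := fun p h1 h2 =>
    natDegree_le_pred h1 h2
  by_cases h2 : h.coeff 2 = 0
  · have h3 := coeff_two_ne_zero_of_max_natDegree hdeg h2
    exact two_mul_ncard_primitiveInertSet_of_natDegree_le_one hgh
      (le_antisymm hg (le_natDegree_of_ne_zero h3)) (hlt h hh h2) hW k hr hn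
  -- The constant is the value of `g / h` at infinity. Subtracting it and inverting moves that value
  -- to infinity, so the new denominator has degree at most one.
  · have hcop : IsCoprime h (g - C (g.coeff 2 / h.coeff 2) * h) := by
      obtain ⟨a, b, hab⟩ := hgh
      exact ⟨b + a * C (g.coeff 2 / h.coeff 2), a, by linear_combination hab⟩
    have hd : (g - C (g.coeff 2 / h.coeff 2) * h).natDegree ≤ 1 := by
      refine hlt _ (natDegree_sub_le_of_le hg ((natDegree_C_mul_le _ _).trans hh)) ?_
      rw [coeff_sub, coeff_C_mul, div_mul_cancel₀ _ h2, sub_self]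
    have hW' : wronskian (g - C (g.coeff 2 / h.coeff 2) * h) h ≠ 0 := by
      intro h0
      apply hW
      rw [← neg_eq_zero, wronskian_neg_eq, ← h0]
      simp only [wronskian, derivative_sub, derivative_mul, derivative_C]
      ring
    rw [← ncard_primitiveInertSet_sub_C_mul g h (g.coeff 2 / h.coeff 2) hn]
    exact two_mul_ncard_primitiveInertSet_of_natDegree_le_one hcop
      (le_antisymm hh (le_natDegree_of_ne_zero h2)) hd hW' k hr hn

end Final

/-! ### Assembling the three cases. -/

theorem Nat.filter_odd_divisors_two_pow_mul (k : ℕ) {r : ℕ} (hr : Odd r) :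
    {d ∈ (2 ^ k * r).divisors | Odd d} = r.divisors := by
  ext d
  simp only [Finset.mem_filter, Nat.mem_divisors]
  constructor
  · rintro ⟨⟨hd, -⟩, hodd⟩
    exact ⟨((Nat.coprime_two_right.mpr hodd).pow_right k).dvd_of_dvd_mul_left hd, hr.pos.ne'⟩
  · rintro ⟨hd, -⟩
    exact ⟨⟨hd.mul_left _, mul_ne_zero (Nat.two_pow_pos k).ne' hr.pos.ne'⟩, hr.of_dvd_nat hd⟩

/-- The finiteness clause gives `ncard` its intended meaning, since `ncard` is `0` on infinite sets.
-/
theorem theorem3p3 {F : Type*} [Field F] [Fintype F] (q : ℕ) (hq : Fintype.card F = q)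
    (g h : F[X]) (hgh : IsCoprime g h) (hdeg : max g.natDegree h.natDegree = 2)
    (n : ℕ) (hn : 1 < n) :
    (irreducibleTransformSet g h n).Finite ∧
    ((Even q ∧ derivative g = 0 ∧ derivative h = 0) →
      (irreducibleTransformSet g h n).ncard = 0) ∧
    ((Odd q ∧ ∃ k : ℕ, n = 2 ^ k) →
      ((irreducibleTransformSet g h n).ncard : ℚ) = 1 / (2 * (n : ℚ)) * ((q : ℚ) ^ n - 1)) ∧
    ((¬ (Even q ∧ derivative g = 0 ∧ derivative h = 0) ∧ ¬ (Odd q ∧ ∃ k : ℕ, n = 2 ^ k)) →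
      ((irreducibleTransformSet g h n).ncard : ℚ) =
        1 / (2 * (n : ℚ)) *
          ∑ d ∈ n.divisors with Odd d, (ArithmeticFunction.moebius d : ℚ) * (q : ℚ) ^ (n / d)) := by
  subst hq
  obtain ⟨hfin, hcard⟩ :=
    finite_irreducibleTransformSet_and_ncard (A := AlgebraicClosure F) hgh hdeg hn
  have hWiff := hgh.symm.wronskian_eq_zero_iff
  have hn0 : (n : ℚ) ≠ 0 := by
    have : n ≠ 0 := by omega
    exact_mod_cast this
  -- By coprimality a zero Wronskian forces `g' = h' = 0`; with `2` invertible this kills both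
  -- quadratic coefficients, against `hdeg`.
  have hodd : Odd (Fintype.card F) → wronskian h g ≠ 0 := by
    intro hq h0
    obtain ⟨hh', hg'⟩ := hWiff.mp h0
    have h2 : (2 : F) ≠ 0 := by
      intro h2
      obtain ⟨c, hc⟩ := hq
      have := FiniteField.cast_card_eq_zero F
      rw [hc] at this
      simp [h2] at this
    have hcoeff : ∀ p : F[X], derivative p = 0 → p.coeff 2 = 0 := by
      intro p hp
      have := congrArg (fun p => coeff p 1) hp
      simp only [coeff_derivative, coeff_zero, Nat.cast_one, one_add_one_eq_two] at this
      exact (mul_eq_zero.mp this).resolve_right h2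
    exact coeff_two_ne_zero_of_max_natDegree hdeg (hcoeff h hh') (hcoeff g hg')
  obtain ⟨k, r, hr2, hnr⟩ := Nat.exists_eq_pow_mul_and_not_dvd (n := n) (by omega) 2 (by norm_num)
  have hr : Odd r := by rwa [← Nat.not_even_iff_odd, even_iff_two_dvd]
  have hpow : (∃ k : ℕ, n = 2 ^ k) ↔ r = 1 := by
    constructor
    · rintro ⟨j, hj⟩
      have : r ∣ 2 ^ j := ⟨2 ^ k, by rw [← hj, hnr, mul_comm]⟩
      exact Nat.Coprime.eq_one_of_dvd ((Nat.coprime_two_right.mpr hr).pow_right j) this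
    · rintro rfl
      exact ⟨k, by simpa using hnr⟩
  have hmain : wronskian h g ≠ 0 → ((irreducibleTransformSet g h n).ncard : ℚ) =
      1 / (2 * (n : ℚ)) * ((∑ d ∈ n.divisors with Odd d,
        (ArithmeticFunction.moebius d : ℚ) * (Fintype.card F : ℚ) ^ (n / d)) -
      if r = 1 ∧ Odd (Fintype.card F) then 1 else 0) := by
    intro hW
    have hsum : ∑ d ∈ n.divisors with Odd d,
        (ArithmeticFunction.moebius d : ℚ) * (Fintype.card F : ℚ) ^ (n / d) =
        ∑ d ∈ r.divisors, (ArithmeticFunction.moebius d : ℚ) *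
          (Fintype.card F : ℚ) ^ (2 ^ k * (r / d)) := by
      rw [hnr, Nat.filter_odd_divisors_two_pow_mul k hr]
      refine Finset.sum_congr rfl fun d hd => ?_
      rw [Nat.mul_div_assoc _ (Nat.mem_divisors.mp hd).1]
    have e := two_mul_ncard_primitiveInertSet_of_max_natDegree (A := AlgebraicClosure F)
      hgh hdeg hW k hr (hnr ▸ hn)
    rw [hsum, ← e, ← hnr, hcard]
    push_cast
    field_simp
  refine ⟨hfin, ?_, ?_, ?_⟩
  · rintro ⟨-, hg', hh'⟩
    rw [primitiveInertSet_eq_empty_of_wronskian_eq_zero hgh hdeg (hWiff.mpr ⟨hh', hg'⟩) hn,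
      Set.ncard_empty, zero_eq_mul] at hcard
    exact hcard.resolve_left (by omega)
  · rintro ⟨hq, hk⟩
    -- For a power of two the only odd divisor is `1`, so the sum is `q ^ n`.
    rw [hmain (hodd hq), if_pos ⟨hpow.mp hk, hq⟩, hnr,
      Nat.filter_odd_divisors_two_pow_mul k hr, hpow.mp hk]
    simp
  · rintro ⟨h1, h2⟩
    have hW : wronskian h g ≠ 0 := by
      rcases Nat.even_or_odd (Fintype.card F) with hq | hq
      · exact fun h0 => h1 ⟨hq, (hWiff.mp h0).2, (hWiff.mp h0).1⟩
      · exact hodd hq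
    rw [hmain hW, if_neg fun H => h2 ⟨H.2, hpow.mpr H.1⟩, sub_zero]
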